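/- Let $G$ be a finite Abelian group with dual group $\widehat G$. For $f,g\colon G\to\mathbb{C}$ let $V_gf(x,\xi)=\sum_{y\in G} f(y)\overline{g(y-x)}\,\overline{\xi(y)}$, $(x,\xi)\in G\times\widehat G$, be the short-time Fourier transform of $f$ with window $g$, let $\|\cdot\|_0$ denote the number of points at which a function does not vanish, and for $1\le k\le |G|$ put $$\phi(G,k)=\max_{g\in\mathbb{C}^G\setminus\{0\}}\ \min\{\|V_gf\|_0:\ f\in\mathbb{C}^G,\ 0<\|f\|_0\le k\}.$$ Proposition. Let $p,q$ be primes with $q<p$, let $G=\mathbb{Z}_{pq}$ and $1\le k\le pq$, and put $$B(p,q,k)=\begin{cases} p^2(q^2-k+1) & \text{if } k<q,\\ \left(p^2-\tfrac kq+1\right)(q^2-q+1) & \text{otherwise.}\end{cases}$$ Then $\phi(G,k)\ge B(p,q,k)$. Moreover, let $d_1$ be the largest divisor of $|G|=pq$ with $d_1\le k$ and $d_2$ the smallest divisor of $pq$ with $d_2\ge k$. Then this bound improves the bound $\frac{|G|^2}{d_1d_2}(d_1+d_2-k)$ stated for general finite Abelian groups, in the sense that $B(p,q,k)\ge\frac{p^2q^2}{d_1d_2}(d_1+d_2-k)$,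 with strict inequality whenever $k\ge 2$. -/

import Mathlib

/-- `‖f‖₀`, the number of points at which `f` does not vanish. -/
noncomputable def zeroNorm {A : Type*} (f : A → ℂ) : ℕ := (Function.support f).ncard

/-- The short-time Fourier transform `V_g f` with window `g` on a finite Abelian group `G`.
The dual group is `AddChar G ℂ`: on a finite group every character into `ℂ` automatically takes
its values in the unit circle. -/
noncomputable def stft {G : Type*} [AddCommGroup G] [Fintype G] (g f : G → ℂ) :
    G × AddChar G ℂ → ℂ :=
  fun l => ∑ y : G, f y * starRingEnd ℂ (g (y - l.1)) * starRingEnd ℂ (l.2 y)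

/-- The values `‖V_g f‖₀` for `f` with `0 < ‖f‖₀ ≤ k`. -/
def stftNorms {G : Type*} [AddCommGroup G] [Fintype G] (g : G → ℂ) (k : ℕ) : Set ℕ :=
  {n | ∃ f : G → ℂ, 0 < zeroNorm f ∧ zeroNorm f ≤ k ∧ zeroNorm (stft g f) = n}

/-- The values, over all nonzero windows `g`, of the minimum of `‖V_g f‖₀` over `0 < ‖f‖₀ ≤ k`. -/
def stftMinima (G : Type*) [AddCommGroup G] [Fintype G] (k : ℕ) : Set ℕ :=
  {m | ∃ g : G → ℂ, g ≠ 0 ∧ IsLeast (stftNorms g k) m}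

/-- `φ(G, k) = max_{g ≠ 0} min {‖V_g f‖₀ : 0 < ‖f‖₀ ≤ k}`; for `1 ≤ k` the maximum and the minima
are attained, see `stftPhi_isGreatest`. -/
noncomputable def stftPhi (G : Type*) [AddCommGroup G] [Fintype G] (k : ℕ) : ℕ :=
  sSup (stftMinima G k)

/-- The piecewise bound `p²(q² - k + 1)` for `k < q`, `(p² - k/q + 1)(q² - q + 1)` otherwise. -/
noncomputable def pqBound (p q k : ℕ) : ℝ :=
  if k < q then (p : ℝ) ^ 2 * ((q : ℝ) ^ 2 - k + 1)
  else ((p : ℝ) ^ 2 - (k : ℝ) / q + 1) * ((q : ℝ) ^ 2 - q + 1)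

theorem stftPhi_isGreatest (G : Type*) [AddCommGroup G] [Fintype G] (k : ℕ) (hk : 1 ≤ k) :
    IsGreatest (stftMinima G k) (stftPhi G k) := by
  classical
  have hne : ∀ g : G → ℂ, (stftNorms g k).Nonempty := by
    intro g
    have h : zeroNorm (Pi.single (0 : G) (1 : ℂ)) = 1 := by
      have hs : Function.support (Pi.single (0 : G) (1 : ℂ)) = {0} := by
        ext x
        simp
      rw [zeroNorm, hs, Set.ncard_singleton]
    exact ⟨_, Pi.single 0 1, by omega, by omega, rfl⟩
  have hnonempty : (stftMinima G k).Nonempty := by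
    refine ⟨sInf (stftNorms (1 : G → ℂ) k), 1, one_ne_zero, Nat.sInf_mem (hne 1), ?_⟩
    exact fun n hn => Nat.sInf_le hn
  have hbdd : BddAbove (stftMinima G k) := by
    refine ⟨Nat.card (G × AddChar G ℂ), ?_⟩
    rintro m ⟨g, -, ⟨f, -, -, rfl⟩, -⟩
    exact Set.ncard_le_card _
  exact ⟨Nat.sSup_mem hnonempty hbdd, fun m hm => le_csSup hbdd hm⟩

/-! On a group of prime order `p` some window has all Gabor minors nonzero: for the window `t ^ 3 ^
d.val` each minor is a polynomial in `t` whose leading coefficient is, up to sign, a product of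
Fourier minors, nonzero by Chebotarev, and some `t` avoids the finitely many roots. Then `V_g f`
cannot vanish at `‖f‖₀` points, so `‖V_g f‖₀ + ‖f‖₀ ≥ p² + 1` (`exists_window_le_zeroNorm_add`).

On `ZMod (p * q) ≃ ZMod p × ZMod q` take the tensor product of two such windows. If `f` has `s`
nonzero rows, the sparsest with `t` nonzero entries, then `s * t ≤ ‖f‖₀` and `‖V_g f‖₀ ≥ (p² + 1 -
s)(q² + 1 - t)` (`mul_le_zeroNorm_stft_tensor`). Minimising over `s ≤ p`, `t ≤ q`, `s * t ≤ k` gives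
`pqBound_le_mul`. -/

/-! ### Chebotarev's theorem on Fourier minors -/

-- The operator `X · d/dX` multiplies the `j`-th coefficient by `a j` and lowers the order of
-- vanishing at 1 by at most one. Evaluating its iterates at 1 gives a Vandermonde system for `c`,
-- with nodes distinct modulo `p`.
open Polynomial in
theorem eq_zero_of_X_sub_one_pow_dvd_sum {S : Type*} [CommRing S] [IsDomain S] (p : ℕ) [CharP S p]
    {ι : Type*} [Fintype ι] {a : ι → ℕ} (ha : Function.Injective a) (hap : ∀ j, a j < p)
    (c : ι → S) (h : (X - 1 : S[X]) ^ Fintype.card ι ∣ ∑ j, C (c j) * X ^ a j) : c = 0 := by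
  have key : ∀ m ≤ Fintype.card ι, (X - 1 : S[X]) ^ (Fintype.card ι - m) ∣
      ∑ j, C (c j * (a j : S) ^ m) * X ^ a j := by
    intro m
    induction m with
    | zero => intro _; simpa using h
    | succ m ih =>
      intro hm
      have h1 := pow_sub_one_dvd_derivative_of_pow_dvd (ih (by omega))
      have h2 := h1.mul_left X
      rw [Nat.sub_sub] at h2
      convert h2 using 1
      rw [derivative_sum, Finset.mul_sum]
      refine Finset.sum_congr rfl fun j _ => ?_
      rw [derivative_C_mul_X_pow]
      rcases Nat.eq_zero_or_pos (a j) with h0 | h0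
      · simp [h0]
      · obtain ⟨b, hb⟩ : ∃ b, a j = b + 1 := ⟨a j - 1, by omega⟩
        rw [hb]
        simp only [Nat.add_sub_cancel, C_mul, C_pow]
        ring
  have hsum : ∀ m < Fintype.card ι, ∑ j, c j * (a j : S) ^ m = 0 := by
    intro m hm
    obtain ⟨g, hg⟩ := key m hm.le
    have := congrArg (eval 1) hg
    simpa [eval_finsetSum, Nat.sub_ne_zero_of_lt hm] using this
  have hinj : Function.Injective fun j => (a j : S) := fun i j hij =>
    ha (CharP.natCast_injOn_Iio S p (hap i) (hap j) hij)
  let e := Fintype.equivFin ι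
  have hz : c ∘ e.symm = 0 := by
    refine Matrix.eq_zero_of_forall_pow_sum_mul_pow_eq_zero
      (f := fun i => (a (e.symm i) : S)) (hinj.comp e.symm.injective) fun i => ?_
    rw [← hsum i i.2]
    exact e.symm.sum_comp fun j => c j * (a j : S) ^ (i : ℕ)
  funext j
  simpa using congrFun hz (e j)

/-- A form of **Chebotarev's theorem**: minors of the Fourier matrix of prime order `p` do not vanish
in a ring in which `ζ - 1` is prime. -/
theorem IsPrimitiveRoot.det_pow_mul_ne_zero {R : Type*} [CommRing R] [IsDomain R] [WfDvdMonoid R]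
    {p : ℕ} [hp : Fact p.Prime] {ζ : R} (hζ : IsPrimitiveRoot ζ p) (hprime : Prime (ζ - 1))
    {ι : Type*} [Fintype ι] [DecidableEq ι] {a b : ι → ℕ}
    (ha : Function.Injective a) (hap : ∀ j, a j < p)
    (hb : Function.Injective b) (hbp : ∀ j, b j < p) :
    (Matrix.of fun i j => ζ ^ (b i * a j)).det ≠ 0 := by
  intro hdet
  obtain ⟨v, hv, hMv⟩ := Matrix.exists_mulVec_eq_zero_iff.2 hdet
  -- A kernel vector is the coefficient vector of a sparse polynomial with the roots `ζ ^ b i`, all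
  -- of which become 1 modulo `ζ - 1`, so the preceding lemma applies in the quotient.
  have hdvd : ∀ v : ι → R, (Matrix.of fun i j => ζ ^ (b i * a j)).mulVec v = 0 →
      ∀ j, ζ - 1 ∣ v j := by
    intro v hMv
    set f : Polynomial R := ∑ j, Polynomial.C (v j) * Polynomial.X ^ a j with hf
    have hroot : ∀ i, f.IsRoot (ζ ^ b i) := by
      intro i
      have := congrFun hMv i
      simp only [Matrix.mulVec, dotProduct, Matrix.of_apply, Pi.zero_apply] at this
      rw [Polynomial.IsRoot.def, hf, Polynomial.eval_finsetSum, ← this]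
      refine Finset.sum_congr rfl fun j _ => ?_
      rw [Polynomial.eval_mul, Polynomial.eval_C, Polynomial.eval_pow, Polynomial.eval_X, ← pow_mul,
        mul_comm]
    have hinj : Function.Injective fun i => ζ ^ b i := fun i j hij =>
      hb (hζ.pow_inj (hbp i) (hbp j) hij)
    have hprod : ∏ i, (Polynomial.X - Polynomial.C (ζ ^ b i)) ∣ f := by
      by_cases hf0 : f = 0
      · simp [hf0]
      · have := (Multiset.prod_X_sub_C_dvd_iff_le_roots hf0
          (Finset.univ.val.map fun i => ζ ^ b i)).2
          ((Multiset.le_iff_subset (Multiset.Nodup.map hinj Finset.univ.nodup)).2 fun x hx => by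
            obtain ⟨i, -, rfl⟩ := Multiset.mem_map.1 hx
            exact (Polynomial.mem_roots hf0).2 (hroot i))
        simpa [Multiset.map_map] using this
    let S := R ⧸ Ideal.span {ζ - 1}
    have : (Ideal.span {ζ - 1}).IsPrime :=
      (Ideal.span_singleton_prime hprime.ne_zero).2 hprime
    have hz1 : Ideal.Quotient.mk (Ideal.span {ζ - 1}) ζ = 1 := by
      rw [← map_one (Ideal.Quotient.mk (Ideal.span {ζ - 1})), Ideal.Quotient.mk_eq_mk_iff_sub_mem]
      exact Ideal.mem_span_singleton_self _
    have hp0 : ((p : ℕ) : S) = 0 := by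
      have h := congrArg (Ideal.Quotient.mk (Ideal.span {ζ - 1}))
        (hζ.geom_sum_eq_zero hp.out.one_lt)
      simpa [map_sum, hz1] using h
    have : CharP S p := by
      obtain ⟨r, hr⟩ := CharP.exists S
      have hrp : r ∣ p := (CharP.cast_eq_zero_iff S r p).1 hp0
      rcases (Nat.dvd_prime hp.out).1 hrp with h | h
      · exact absurd h (CharP.char_ne_one S r)
      · exact h ▸ hr
    have hmap := Polynomial.map_dvd (Ideal.Quotient.mk (Ideal.span {ζ - 1})) hprod
    have hc := eq_zero_of_X_sub_one_pow_dvd_sum (S := S) p ha hap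
      (fun j => Ideal.Quotient.mk (Ideal.span {ζ - 1}) (v j)) (by
        simpa [hf, Polynomial.map_prod, Polynomial.map_sum, hz1, Finset.prod_const] using hmap)
    intro j
    exact Ideal.mem_span_singleton.1 (Ideal.Quotient.eq_zero_iff_mem.1 (congrFun hc j))
  obtain ⟨j, hj⟩ := Function.ne_iff.1 hv
  -- Dividing a kernel vector by `ζ - 1` leaves a kernel vector, and a nonzero entry cannot be
  -- divided indefinitely.
  have descent : ∀ r : R, ∀ v : ι → R, v j = r → r ≠ 0 →
      (Matrix.of fun i j => ζ ^ (b i * a j)).mulVec v ≠ 0 := by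
    intro r
    induction r using WellFounded.induction
      (wellFounded_dvdNotUnit : WellFounded (DvdNotUnit (α := R))) with
    | _ r ih =>
      rintro v rfl hr hMv
      choose u hu using hdvd v hMv
      have hvu : v = (ζ - 1) • u := funext hu
      have huj : u j ≠ 0 := fun h => hr (by rw [hu, h, mul_zero])
      refine ih (u j) ⟨huj, ζ - 1, hprime.not_isUnit, by rw [hu j, mul_comm]⟩ u rfl huj ?_
      rw [hvu, Matrix.mulVec_smul] at hMv
      exact (smul_eq_zero.1 hMv).resolve_left hprime.ne_zero
  exact descent (v j) v rfl hj hMv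

/-- **Chebotarev's theorem** on the minors of the Fourier matrix of a cyclic group of prime order. -/
theorem AddChar.det_ne_zero_of_prime {p : ℕ} [hp : Fact p.Prime] {ι : Type*} [Fintype ι]
    [DecidableEq ι] {y : ι → ZMod p} (hy : Function.Injective y)
    {ξ : ι → AddChar (ZMod p) ℂ} (hξ : Function.Injective ξ) :
    (Matrix.of fun i j => ξ j (y i)).det ≠ 0 := by
  let K := CyclotomicField p ℚ
  have : IsCyclotomicExtension {p} ℚ K := CyclotomicField.isCyclotomicExtension p ℚ
  have hζ := IsCyclotomicExtension.zeta_spec p ℚ K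
  let φ : NumberField.RingOfIntegers K →+* ℂ :=
    (Classical.arbitrary (K →+* ℂ)).comp (algebraMap _ K)
  have hφ : Function.Injective φ :=
    (Classical.arbitrary (K →+* ℂ)).injective.comp NumberField.RingOfIntegers.coe_injective
  have hζ' := hζ.toInteger_isPrimitiveRoot
  have hω := hζ'.map_of_injective hφ
  have hval : ∀ (χ : AddChar (ZMod p) ℂ) (x : ZMod p), χ x = χ 1 ^ x.val := by
    intro χ x
    rw [← AddChar.map_nsmul_eq_pow]
    simp
  have hpow : ∀ j, ∃ n < p, φ hζ.toInteger ^ n = ξ j 1 := by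
    intro j
    refine hω.eq_pow_of_pow_eq_one ?_
    rw [← AddChar.map_nsmul_eq_pow]
    simp
  choose a hap ha using hpow
  have hainj : Function.Injective a := by
    intro i j hij
    refine hξ (DFunLike.ext _ _ fun x => ?_)
    rw [hval, hval (ξ j), ← ha, ← ha, hij]
  have hdet := hζ'.det_pow_mul_ne_zero hζ.zeta_sub_one_prime' hainj hap
    (b := fun i => (y i).val) ((ZMod.val_injective p).comp hy) (fun i => ZMod.val_lt _)
  have := (map_ne_zero_iff φ hφ).2 hdet
  rw [RingHom.map_det] at this
  convert this using 2
  ext i j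
  simp [hval (ξ j) (y i), ← ha, ← pow_mul, mul_comm]

/-! ### Uniqueness of the optimal assignment -/

theorem exists_eq_and_ne_of_perm {ι α : Type*} [Finite ι] {f : ι → α} (ρ : Equiv.Perm ι)
    {i : ι} {c : α} (hf : f i = c) (hρ : f (ρ i) ≠ c) : ∃ j, f (ρ j) = c ∧ f j ≠ c := by
  classical
  cases nonempty_fintype ι
  by_contra! h
  have hsub : Finset.univ.filter (fun j => f (ρ j) = c) ⊆ Finset.univ.filter (fun j => f j = c) :=
    fun j hj => by
      simp only [Finset.mem_filter, Finset.mem_univ, true_and] at hj ⊢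
      exact h j hj
  have hcard : (Finset.univ.filter fun j => f (ρ j) = c).card =
      (Finset.univ.filter fun j => f j = c).card :=
    Finset.card_equiv ρ fun j => by simp
  have hi : i ∈ Finset.univ.filter fun j => f (ρ j) = c := by
    rw [Finset.eq_of_subset_of_card_le hsub hcard.ge]
    simpa using hf
  exact hρ (by simpa using hi)

section Assignment

variable {G ι : Type*} [AddCommGroup G] [Fintype ι]

/-- The total weight of an assignment of the points `x i` to the points `y i`, a difference of rank
`r` having weight `3 ^ r`. -/
def assignmentWeight (r : G → ℕ) (y x : ι → G) : ℕ := ∑ i, 3 ^ r (y i - x i)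

/-- Exchange argument: `x ∘ ρ` takes the value `x i` at some other `j`, and swapping gives it to `y
i`. This gains a term `3 ^ R` and loses two terms of rank below `R`; base 3 makes `2 * 3 ^ (R - 1) <
3 ^ R`. -/
theorem assignmentWeight_lt_swap [DecidableEq ι] {r : G → ℕ} (hr : Function.Injective r)
    {y : ι → G} (hy : Function.Injective y) {x : ι → G} (ρ : Equiv.Perm ι) {i : ι}
    (hi : x (ρ i) ≠ x i)
    (hmax : ∀ j, x (ρ j) ≠ x j → r (y j - x (ρ j)) ≤ r (y i - x i)) :
    ∃ τ : Equiv.Perm ι, assignmentWeight r y (x ∘ ρ) < assignmentWeight r y (x ∘ τ) := by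
  obtain ⟨j, hj, hj'⟩ := exists_eq_and_ne_of_perm (f := x) ρ rfl hi
  have hij : i ≠ j := by
    rintro rfl
    exact hj' rfl
  refine ⟨(Equiv.swap i j).trans ρ, ?_⟩
  have h1 : r (y i - x (ρ i)) < r (y i - x i) :=
    lt_of_le_of_ne (hmax i hi) fun h => hi (by simpa using hr h)
  have h2 : r (y j - x i) < r (y i - x i) :=
    lt_of_le_of_ne (by simpa [hj] using hmax j (by rw [hj]; exact hj'.symm))
      fun h => hij (hy (by simpa using (hr h).symm))
  have hi' : i ∈ Finset.univ.erase j := by simp [hij]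
  unfold assignmentWeight
  rw [← Finset.add_sum_erase _ _ (Finset.mem_univ j),
    ← Finset.add_sum_erase _ (fun l => 3 ^ r (y l - (x ∘ (Equiv.swap i j).trans ρ) l))
      (Finset.mem_univ j), ← Finset.add_sum_erase _ _ hi', ← Finset.add_sum_erase _ _ hi']
  have hrest : ∑ l ∈ (Finset.univ.erase j).erase i, 3 ^ r (y l - (x ∘ ρ) l) =
      ∑ l ∈ (Finset.univ.erase j).erase i, 3 ^ r (y l - (x ∘ (Equiv.swap i j).trans ρ) l) := by
    refine Finset.sum_congr rfl fun l hl => ?_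
    simp only [Finset.mem_erase, Finset.mem_univ, and_true] at hl
    simp [Equiv.swap_apply_of_ne_of_ne hl.1 hl.2]
  rw [hrest]
  generalize ∑ l ∈ (Finset.univ.erase j).erase i,
    3 ^ r (y l - (x ∘ (Equiv.swap i j).trans ρ) l) = rest
  simp only [Function.comp_apply, Equiv.trans_apply, Equiv.swap_apply_left,
    Equiv.swap_apply_right, hj]
  have e1 : 3 * 3 ^ r (y i - x (ρ i)) ≤ 3 ^ r (y i - x i) := by
    rw [← pow_succ']
    exact Nat.pow_le_pow_right (by norm_num) h1
  have e2 : 3 * 3 ^ r (y j - x i) ≤ 3 ^ r (y i - x i) := by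
    rw [← pow_succ']
    exact Nat.pow_le_pow_right (by norm_num) h2
  have e3 : 0 < 3 ^ r (y i - x i) := by positivity
  have e4 : 0 < 3 ^ r (y j - x (ρ i)) := by positivity
  omega

/-- If two optimal assignments differed, take the largest rank occurring in either of them where
they disagree: the one not attaining it could be improved by a swap. -/
theorem comp_eq_of_assignmentWeight_max {r : G → ℕ} (hr : Function.Injective r)
    {y : ι → G} (hy : Function.Injective y) {x : ι → G}
    (hx : ∀ τ : Equiv.Perm ι, assignmentWeight r y (x ∘ τ) ≤ assignmentWeight r y x)
    {ρ : Equiv.Perm ι} (hρ : assignmentWeight r y (x ∘ ρ) = assignmentWeight r y x) :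
    x ∘ ρ = x := by
  classical
  by_contra hne
  obtain ⟨i₀, hi₀⟩ := Function.ne_iff.1 hne
  obtain ⟨i, hi, hmax⟩ := Finset.exists_max_image (Finset.univ.filter fun i => x (ρ i) ≠ x i)
    (fun i => max (r (y i - x (ρ i))) (r (y i - x i))) ⟨i₀, by simpa using hi₀⟩
  simp only [Finset.mem_filter, Finset.mem_univ, true_and] at hi hmax
  rcases le_total (r (y i - x (ρ i))) (r (y i - x i)) with h | h
  · obtain ⟨τ, hτ⟩ := assignmentWeight_lt_swap hr hy ρ hi fun j hj => by
      have := hmax j hj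
      rw [max_eq_right h] at this
      exact (le_max_left _ _).trans this
    exact (hτ.trans_le (hx τ)).ne hρ
  · obtain ⟨τ, hτ⟩ := assignmentWeight_lt_swap hr hy (x := x ∘ ρ) ρ⁻¹ (i := i)
      (by simpa using hi.symm) fun j hj => by
        have := hmax j (by simpa using hj.symm)
        rw [max_eq_left h] at this
        simpa using (le_max_right _ _).trans this
    have hcancel : (x ∘ ρ) ∘ ⇑ρ⁻¹ = x := by
      ext l
      simp
    rw [hcancel] at hτ
    exact absurd (hx (ρ * τ)) (not_le.2 hτ)

end Assignment

/-! ### Gabor minors on groups of prime order -/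

section Block

variable {p : ℕ} [Fact p.Prime] {ι : Type*} [Fintype ι] [DecidableEq ι]

/-- Grouping indices by the value of `x` makes the matrix block diagonal, each block being a Fourier
minor. -/
theorem AddChar.det_block_ne_zero {y : ι → ZMod p} (hy : Function.Injective y)
    {x : ι → ZMod p} {ξ : ι → AddChar (ZMod p) ℂ}
    (hxξ : Function.Injective fun i => (x i, ξ i)) :
    (Matrix.of fun i j => if x i = x j then ξ j (y i) else 0).det ≠ 0 := by
  classical
  intro hdet
  obtain ⟨v, hv, hMv⟩ := Matrix.exists_mulVec_eq_zero_iff.2 hdet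
  refine hv (funext fun j₀ => ?_)
  let κ := {i // x i = x j₀}
  have hu : (fun j : κ => v j) = 0 := by
    refine Matrix.eq_zero_of_mulVec_eq_zero (AddChar.det_ne_zero_of_prime
      (y := fun i : κ => y i) (ξ := fun j : κ => ξ j) (hy.comp Subtype.val_injective)
      fun i j hij => Subtype.ext (hxξ (Prod.ext (i.2.trans j.2.symm) hij))) ?_
    funext i
    have := congrFun hMv i
    simp only [Matrix.mulVec, dotProduct, Matrix.of_apply, Pi.zero_apply, ite_mul, zero_mul] at this ⊢
    rw [← this, ← Finset.sum_filter]
    exact (Finset.sum_subtype (Finset.univ.filter fun j => x i = x j)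
      (by intro j; simp [i.2, eq_comm]) fun j => ξ j (y i) * v j).symm
  exact congrFun hu ⟨j₀, rfl⟩

open Polynomial in
theorem AddChar.det_mul_X_pow_ne_zero {r : ZMod p → ℕ} (hr : Function.Injective r)
    {y : ι → ZMod p} (hy : Function.Injective y)
    {x : ι → ZMod p} {ξ : ι → AddChar (ZMod p) ℂ}
    (hxξ : Function.Injective fun i => (x i, ξ i)) :
    (Matrix.of fun i j => C (ξ j (y i)) * (X : ℂ[X]) ^ 3 ^ r (y i - x j)).det ≠ 0 := by
  -- Rows are permuted so that the identity assignment is optimal; the determinant changes only by a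
  -- sign.
  obtain ⟨σ, hσ⟩ := Finite.exists_max fun σ : Equiv.Perm ι => assignmentWeight r (y ∘ σ) x
  have hweight : ∀ (z : ι → ZMod p) (τ : Equiv.Perm ι),
      assignmentWeight r z (x ∘ τ.symm) = assignmentWeight r (z ∘ τ) x := fun z τ => by
    simpa [assignmentWeight] using
      (Equiv.sum_comp τ fun i => 3 ^ r (z i - x (τ.symm i))).symm
  set z := y ∘ σ with hz
  have hzinj : Function.Injective z := hy.comp σ.injective
  have hmax : ∀ τ : Equiv.Perm ι, assignmentWeight r z (x ∘ τ) ≤ assignmentWeight r z x := by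
    intro τ
    have := hweight z τ.symm
    rw [Equiv.symm_symm] at this
    rw [this]
    exact hσ (σ * τ.symm)
  suffices h : (Matrix.of fun i j => C (ξ j (z i)) * (X : ℂ[X]) ^ 3 ^ r (z i - x j)).det ≠ 0 by
    intro h0
    apply h
    have := Matrix.det_permute σ (Matrix.of fun i j => C (ξ j (y i)) * (X : ℂ[X]) ^ 3 ^ r (y i - x j))
    rw [h0, mul_zero] at this
    exact this
  intro h0
  refine AddChar.det_block_ne_zero hzinj hxξ ?_
  -- In the Leibniz expansion `τ` contributes in degree `assignmentWeight r z (x ∘ τ.symm)`. This is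
  -- maximal only when `τ` preserves the fibres of `x`, so the coefficient at the maximal weight is
  -- the block determinant.
  have hcoeff := congrArg (fun P : ℂ[X] => P.coeff (assignmentWeight r z x)) h0
  simp only [coeff_zero] at hcoeff
  refine Eq.trans ?_ hcoeff
  rw [Matrix.det_apply, Matrix.det_apply, finsetSum_coeff]
  refine Finset.sum_congr rfl fun τ _ => ?_
  rw [coeff_smul]
  congr 1
  simp only [Matrix.of_apply]
  rw [Finset.prod_mul_distrib, Finset.prod_pow_eq_pow_sum, ← map_prod, coeff_C_mul_X_pow]
  have hw : ∑ i, 3 ^ r (z (τ i) - x i) = assignmentWeight r z (x ∘ τ.symm) := (hweight z τ).symm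
  rw [hw]
  by_cases hτ : x ∘ τ.symm = x
  · rw [hτ, if_pos rfl]
    refine Finset.prod_congr rfl fun i _ => if_pos ?_
    have := congrFun hτ (τ i)
    simpa using this.symm
  · rw [if_neg fun h => hτ (comp_eq_of_assignmentWeight_max hr hzinj hmax h.symm)]
    have : ∃ i, x (τ i) ≠ x i := by
      by_contra! h
      exact hτ (funext fun i => by simpa using (h (τ.symm i)).symm)
    obtain ⟨i, hi⟩ := this
    exact Finset.prod_eq_zero (Finset.mem_univ i) (if_neg hi)

end Block

/-- For a group of prime order there is a window all of whose Gabor minors do not vanish. -/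
theorem exists_window_det_ne_zero (p : ℕ) [Fact p.Prime] :
    ∃ g : ZMod p → ℂ, ∀ (Λ : Finset (ZMod p × AddChar (ZMod p) ℂ)) (y : Λ ↪ ZMod p),
      (Matrix.of fun i j : Λ => j.1.2 (y i) * g (y i - j.1.1)).det ≠ 0 := by
  classical
  let P : (Σ Λ : Finset (ZMod p × AddChar (ZMod p) ℂ), Λ ↪ ZMod p) → Polynomial ℂ := fun s =>
    (Matrix.of fun i j : s.1 => Polynomial.C (j.1.2 (s.2 i)) *
      (Polynomial.X : Polynomial ℂ) ^ 3 ^ (s.2 i - j.1.1).val).det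
  have hP : ∏ s, P s ≠ 0 := Finset.prod_ne_zero_iff.2 fun s _ =>
    AddChar.det_mul_X_pow_ne_zero (ZMod.val_injective p) s.2.injective
      (x := fun j : s.1 => j.1.1) (ξ := fun j : s.1 => j.1.2) Subtype.val_injective
  obtain ⟨t, ht⟩ : ∃ t, (∏ s, P s).eval t ≠ 0 := by
    by_contra! h
    exact hP (Polynomial.funext fun t => by simpa using h t)
  refine ⟨fun d => t ^ 3 ^ d.val, fun Λ y => ?_⟩
  rw [Polynomial.eval_prod, Finset.prod_ne_zero_iff] at ht
  have := ht ⟨Λ, y⟩ (Finset.mem_univ _)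
  rw [← Polynomial.coe_evalRingHom, RingHom.map_det] at this
  convert this using 2
  ext i j
  simp

theorem zeroNorm_pos {A : Type*} [Finite A] {f : A → ℂ} : 0 < zeroNorm f ↔ f ≠ 0 := by
  rw [zeroNorm, Set.ncard_pos, Function.support_nonempty_iff]

/-- For a group of prime order there is a window `g` for which `‖V_g f‖₀ ≥ p² - ‖f‖₀ + 1` for every
nonzero `f`. -/
theorem exists_window_le_zeroNorm_add (p : ℕ) [Fact p.Prime] :
    ∃ g : ZMod p → ℂ, ∀ f : ZMod p → ℂ, f ≠ 0 →
      p ^ 2 + 1 ≤ zeroNorm (stft g f) + zeroNorm f := by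
  classical
  obtain ⟨g, hg⟩ := exists_window_det_ne_zero p
  refine ⟨g, fun f hf => ?_⟩
  by_contra! hlt
  have hcard : Nat.card (ZMod p × AddChar (ZMod p) ℂ) = p ^ 2 := by
    rw [Nat.card_eq_fintype_card, Fintype.card_prod, AddChar.card_eq, ZMod.card, sq]
  have hcompl := Set.ncard_add_ncard_compl (Function.support (stft g f))
  rw [hcard] at hcompl
  have hle : zeroNorm f ≤ (Function.support (stft g f))ᶜ.toFinset.card := by
    rw [← Set.ncard_eq_toFinset_card']
    unfold zeroNorm at *
    omega
  obtain ⟨Λ, hΛ, hΛcard⟩ := Finset.exists_subset_card_eq hle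
  have e : Λ ≃ Function.support f := by
    refine Fintype.equivOfCardEq ?_
    rw [Fintype.card_coe, hΛcard, zeroNorm, Set.ncard_eq_toFinset_card', Set.toFinset_card]
  -- The transform conjugates window and character while the minor does not, so the vector killed is
  -- the conjugate of `f`.
  have hzero := Matrix.eq_zero_of_vecMul_eq_zero
    (hg Λ (e.toEmbedding.trans (Function.Embedding.subtype _)))
    (v := fun i => starRingEnd ℂ (f (e i))) (by
      funext l
      have hl : stft g f l.1 = 0 := by simpa using hΛ l.2
      have hl' := congrArg (starRingEnd ℂ) hl
      simp only [stft, map_sum, map_mul, Complex.conj_conj, map_zero] at hl'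
      simp only [Matrix.vecMul, dotProduct, Matrix.of_apply, Pi.zero_apply]
      rw [← hl', ← Finset.sum_subset (Finset.subset_univ (Function.support f).toFinset)
        (fun y _ hy => by
          have : f y = 0 := by simpa using hy
          simp [this]),
        Finset.sum_subtype (Function.support f).toFinset (p := fun y => y ∈ Function.support f)
          (by simp), ← e.sum_comp]
      refine Finset.sum_congr rfl fun i _ => ?_
      simp only [Function.Embedding.trans_apply, Equiv.coe_toEmbedding,
        Function.Embedding.subtype_apply]
      ring)
  obtain ⟨y, hy⟩ := Function.ne_iff.1 hf
  have := congrFun hzero (e.symm ⟨y, hy⟩)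
  simp only [Equiv.apply_symm_apply, Pi.zero_apply, map_eq_zero] at this
  exact hy this

/-! ### Tensor products of windows -/

section Tensor

variable {G A B : Type*} [AddCommGroup G] [AddCommGroup A] [AddCommGroup B]

/-- The point of the time-frequency plane of `G ≃ A × B` given by points of those of `A` and `B`. -/
noncomputable def timeFrequencyPair (e : G ≃+ A × B) (l : A × AddChar A ℂ) (m : B × AddChar B ℂ) :
    G × AddChar G ℂ :=
  (e.symm (l.1, m.1), l.2.compAddMonoidHom ((AddMonoidHom.fst A B).comp e.toAddMonoidHom) *
    m.2.compAddMonoidHom ((AddMonoidHom.snd A B).comp e.toAddMonoidHom))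

theorem timeFrequencyPair_injective (e : G ≃+ A × B) :
    Function.Injective fun z : (A × AddChar A ℂ) × (B × AddChar B ℂ) =>
      timeFrequencyPair e z.1 z.2 := by
  rintro ⟨⟨a, α⟩, ⟨b, β⟩⟩ ⟨⟨a', α'⟩, ⟨b', β'⟩⟩ h
  simp only [timeFrequencyPair, Prod.mk.injEq, EmbeddingLike.apply_eq_iff_eq] at h
  obtain ⟨⟨rfl, rfl⟩, h⟩ := h
  have h1 : α = α' := DFunLike.ext _ _ fun x => by
    simpa [AddChar.mul_apply] using DFunLike.congr_fun h (e.symm (x, 0))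
  have h2 : β = β' := DFunLike.ext _ _ fun x => by
    simpa [AddChar.mul_apply] using DFunLike.congr_fun h (e.symm (0, x))
  rw [h1, h2]

variable [Fintype G] [Fintype A] [Fintype B]

theorem stft_timeFrequencyPair (e : G ≃+ A × B) (g₁ : A → ℂ) (g₂ : B → ℂ) (f : G → ℂ)
    (l : A × AddChar A ℂ) (m : B × AddChar B ℂ) :
    stft (fun y => g₁ (e y).1 * g₂ (e y).2) f (timeFrequencyPair e l m) =
      stft g₁ (fun a => stft g₂ (fun b => f (e.symm (a, b))) m) l := by
  simp only [stft, timeFrequencyPair, Finset.sum_mul]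
  rw [← e.symm.toEquiv.sum_comp, Fintype.sum_prod_type]
  refine Finset.sum_congr rfl fun a _ => Finset.sum_congr rfl fun b _ => ?_
  simp [AddChar.mul_apply]
  ring

/-- Transform the sparsest nonzero row `F a₀` by `g₂`: at least `N - t` points `m` survive. For
each, `a ↦ stft g₂ (F a) m` is nonzero and lives on the `s` nonzero rows, so its transform by `g₁`
has at least `M - s` nonzero values. -/
theorem mul_le_zeroNorm_stft_tensor (e : G ≃+ A × B) {g₁ : A → ℂ} {g₂ : B → ℂ} {M N : ℕ}
    (hg₁ : ∀ f, f ≠ 0 → M ≤ zeroNorm (stft g₁ f) + zeroNorm f)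
    (hg₂ : ∀ f, f ≠ 0 → N ≤ zeroNorm (stft g₂ f) + zeroNorm f)
    {f : G → ℂ} (hf : f ≠ 0) :
    ∃ s t, 1 ≤ s ∧ 1 ≤ t ∧ s ≤ Fintype.card A ∧ t ≤ Fintype.card B ∧ s * t ≤ zeroNorm f ∧
      (M - s) * (N - t) ≤ zeroNorm (stft (fun y => g₁ (e y).1 * g₂ (e y).2) f) := by
  classical
  set F : A → B → ℂ := fun a b => f (e.symm (a, b)) with hF
  set S : Finset A := Finset.univ.filter fun a => F a ≠ 0 with hS
  have hSne : S.Nonempty := by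
    obtain ⟨y, hy⟩ := Function.ne_iff.1 hf
    refine ⟨(e y).1, Finset.mem_filter.2 ⟨Finset.mem_univ _, fun h => hy ?_⟩⟩
    simpa [hF] using congrFun h (e y).2
  obtain ⟨a₀, ha₀, hmin⟩ := S.exists_min_image (fun a => zeroNorm (F a)) hSne
  have ha₀' : F a₀ ≠ 0 := (Finset.mem_filter.1 ha₀).2
  refine ⟨S.card, zeroNorm (F a₀), hSne.card_pos, zeroNorm_pos.2 ha₀', Finset.card_le_univ _,
    ?_, ?_, ?_⟩
  · rw [← Nat.card_eq_fintype_card]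
    exact Set.ncard_le_card _
  · calc S.card * zeroNorm (F a₀) ≤ ∑ a ∈ S, zeroNorm (F a) := by
          simpa using S.card_nsmul_le_sum _ _ hmin
      _ = (S.sigma fun a => (Function.support (F a)).toFinset).card := by
          rw [Finset.card_sigma]
          exact Finset.sum_congr rfl fun a _ => Set.ncard_eq_toFinset_card' _
      _ ≤ zeroNorm f := by
          rw [zeroNorm, Set.ncard_eq_toFinset_card']
          refine Finset.card_le_card_of_injOn (fun z => e.symm (z.1, z.2)) ?_ ?_
          · rintro ⟨a, b⟩ h
            have := (Finset.mem_sigma.1 h).2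
            simpa [hF] using this
          · rintro ⟨a, b⟩ _ ⟨a', b'⟩ _ h
            simpa using h
  · have hrow : ∀ m ∈ (Function.support (stft g₂ (F a₀))).toFinset,
        M - S.card ≤ (Function.support (stft g₁ fun a => stft g₂ (F a) m)).toFinset.card := by
      intro m hm
      have hm' : stft g₂ (F a₀) m ≠ 0 := by simpa using hm
      have h := hg₁ (fun a => stft g₂ (F a) m) fun h => hm' (congrFun h a₀)
      have hle : zeroNorm (fun a => stft g₂ (F a) m) ≤ S.card := by
        rw [zeroNorm, ← Set.ncard_coe_finset]
        refine Set.ncard_le_ncard fun a ha => ?_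
        simp only [hS, Finset.coe_filter, Finset.mem_univ, true_and, Set.mem_ofPred_eq]
        intro h0
        exact ha (by simp [h0, stft])
      rw [← Set.ncard_eq_toFinset_card']
      unfold zeroNorm at *
      omega
    have hcol : N - zeroNorm (F a₀) ≤ (Function.support (stft g₂ (F a₀))).toFinset.card := by
      have := hg₂ (F a₀) ha₀'
      rw [← Set.ncard_eq_toFinset_card']
      unfold zeroNorm at *
      omega
    calc (M - S.card) * (N - zeroNorm (F a₀))
        ≤ (Function.support (stft g₂ (F a₀))).toFinset.card * (M - S.card) := by
          rw [mul_comm]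
          exact Nat.mul_le_mul_right _ hcol
      _ ≤ ∑ m ∈ (Function.support (stft g₂ (F a₀))).toFinset,
            (Function.support (stft g₁ fun a => stft g₂ (F a) m)).toFinset.card := by
          simpa using Finset.card_nsmul_le_sum _ _ _ hrow
      _ = ((Function.support (stft g₂ (F a₀))).toFinset.sigma fun m =>
            (Function.support (stft g₁ fun a => stft g₂ (F a) m)).toFinset).card :=
          (Finset.card_sigma _ _).symm
      _ ≤ _ := by
          rw [zeroNorm, Set.ncard_eq_toFinset_card']
          refine Finset.card_le_card_of_injOn (fun z => timeFrequencyPair e z.2 z.1) ?_ ?_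
          · rintro ⟨m, l⟩ h
            have := (Finset.mem_sigma.1 h).2
            simpa [hF, stft_timeFrequencyPair] using this
          · rintro ⟨m, l⟩ _ ⟨m', l'⟩ _ h
            have := timeFrequencyPair_injective e (a₁ := (l, m)) (a₂ := (l', m')) h
            simp only [Prod.mk.injEq] at this
            obtain ⟨rfl, rfl⟩ := this
            rfl

end Tensor

/-! ### Minimisation over `s` and `t`, and the lower bound for `stftPhi` -/

theorem pqBound_le_mul {p q k s t : ℕ} (hq : 1 ≤ q) (hqp : q < p) (hs : 1 ≤ s) (ht : 1 ≤ t)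
    (hsp : s ≤ p) (htq : t ≤ q) (hst : s * t ≤ k) :
    pqBound p q k ≤ ((p : ℝ) ^ 2 + 1 - s) * ((q : ℝ) ^ 2 + 1 - t) := by
  have hq' : (1 : ℝ) ≤ q := by exact_mod_cast hq
  have hqp' : (q : ℝ) + 1 ≤ p := by exact_mod_cast hqp
  have hs' : (1 : ℝ) ≤ s := by exact_mod_cast hs
  have ht' : (1 : ℝ) ≤ t := by exact_mod_cast ht
  have hsp' : (s : ℝ) ≤ p := by exact_mod_cast hsp
  have htq' : (t : ℝ) ≤ q := by exact_mod_cast htq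
  have hst' : (s : ℝ) * t ≤ k := by exact_mod_cast hst
  -- For `K = s * t` the difference of the two sides is the sum of the quantities in `h2` and `h3`;
  -- equality holds at `s = 1`, `t = K`.
  have small : ∀ K : ℝ, (s : ℝ) * t ≤ K →
      (p : ℝ) ^ 2 * ((q : ℝ) ^ 2 - K + 1) ≤ ((p : ℝ) ^ 2 + 1 - s) * ((q : ℝ) ^ 2 + 1 - t) := by
    intro K hK
    have h1 : (p : ℝ) ^ 2 * (s * t) ≤ (p : ℝ) ^ 2 * K := by gcongr
    have h2 : 0 ≤ ((s : ℝ) - 1) * ((p : ℝ) ^ 2 - (q : ℝ) ^ 2) :=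
      mul_nonneg (by linarith) (by nlinarith)
    have h3 : 0 ≤ ((s : ℝ) - 1) * ((t : ℝ) - 1) * ((p : ℝ) ^ 2 + 1) :=
      mul_nonneg (mul_nonneg (by linarith) (by linarith)) (by positivity)
    nlinarith
  have hQ : 0 < (q : ℝ) ^ 2 - q + 1 := by nlinarith
  unfold pqBound
  split_ifs with hkq
  · exact small k hst'
  · have hkq' : (q : ℝ) ≤ k := by exact_mod_cast not_lt.1 hkq
    rcases le_total ((s : ℝ) * t) q with h | h
    · refine le_trans ?_ (small q h)
      have : 1 ≤ (k : ℝ) / q := (one_le_div (by linarith)).2 hkq'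
      exact mul_le_mul_of_nonneg_right (by linarith) hQ.le
    · have hdiv : (s : ℝ) * t / q ≤ k / q := by gcongr
      refine le_trans (mul_le_mul_of_nonneg_right
        (by linarith : _ ≤ (p : ℝ) ^ 2 - s * t / q + 1) hQ.le) ?_
      have hsq : (s : ℝ) * ((q : ℝ) ^ 2 + 1) ≤ q * ((p : ℝ) ^ 2 + 1) := by
        have : (s : ℝ) * ((q : ℝ) ^ 2 + 1) ≤ p * ((q : ℝ) ^ 2 + 1) := by gcongr
        have h1 : (q : ℝ) * p * (q + 1) ≤ q * p * p := by gcongr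
        nlinarith [mul_le_mul_of_nonneg_right hq' (by linarith : (0 : ℝ) ≤ p)]
      have hd : 0 ≤ ((q : ℝ) - t) * ((p : ℝ) ^ 2 + 1 - s * ((q : ℝ) ^ 2 + 1) / q) := by
        refine mul_nonneg (by linarith) (sub_nonneg.2 ?_)
        rw [div_le_iff₀ (by linarith)]
        linarith
      -- With `k` lowered to `s * t` the excess factors and vanishes at `t = q`, the extremal case.
      have heq : ((p : ℝ) ^ 2 + 1 - s) * ((q : ℝ) ^ 2 + 1 - t) -
          ((p : ℝ) ^ 2 - s * t / q + 1) * ((q : ℝ) ^ 2 - q + 1) =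
          ((q : ℝ) - t) * ((p : ℝ) ^ 2 + 1 - s * ((q : ℝ) ^ 2 + 1) / q) := by
        field_simp
        ring
      linarith

theorem pqBound_le_stftPhi (p q : ℕ) [hp : Fact p.Prime] [hq : Fact q.Prime] (hqp : q < p)
    (k : ℕ) (hk : 1 ≤ k) : pqBound p q k ≤ (stftPhi (ZMod (p * q)) k : ℝ) := by
  obtain ⟨g₁, hg₁⟩ := exists_window_le_zeroNorm_add p
  obtain ⟨g₂, hg₂⟩ := exists_window_le_zeroNorm_add q
  let e : ZMod (p * q) ≃+ ZMod p × ZMod q :=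
    (ZMod.chineseRemainder ((Nat.coprime_primes hp.out hq.out).2 hqp.ne')).toAddEquiv
  set g : ZMod (p * q) → ℂ := fun y => g₁ (e y).1 * g₂ (e y).2 with hg
  have hbound := fun (f : ZMod (p * q) → ℂ) (hf : f ≠ 0) =>
    mul_le_zeroNorm_stft_tensor e hg₁ hg₂ hf
  have hsub : ∀ {n m : ℕ}, m ≤ n → ((n ^ 2 + 1 - m : ℕ) : ℝ) = (n : ℝ) ^ 2 + 1 - m := by
    intro n m h
    rw [Nat.cast_sub (by nlinarith)]
    push_cast
    ring
  have hg0 : g ≠ 0 := by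
    intro h0
    obtain ⟨s, t, -, -, hs, ht, -, h⟩ := hbound 1 one_ne_zero
    rw [ZMod.card] at hs ht
    have hz : zeroNorm (stft g 1) = 0 := by
      have : stft g 1 = 0 := by
        funext l
        simp [stft, h0]
      simp [zeroNorm, this]
    rw [← hg, hz] at h
    have h1 : 0 < p ^ 2 + 1 - s := Nat.sub_pos_of_lt (by nlinarith)
    have h2 : 0 < q ^ 2 + 1 - t := Nat.sub_pos_of_lt (by nlinarith)
    exact absurd h (not_le.2 (Nat.mul_pos h1 h2))
  have hne : (stftNorms g k).Nonempty :=
    ⟨_, Pi.single 0 1, by simp [zeroNorm_pos], by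
      rw [zeroNorm, Pi.support_single_of_ne one_ne_zero, Set.ncard_singleton]
      exact hk, rfl⟩
  have hmem := Nat.sInf_mem hne
  have hle := (stftPhi_isGreatest (ZMod (p * q)) k hk).2
    ⟨g, hg0, hmem, fun n hn => Nat.sInf_le hn⟩
  obtain ⟨f, hf0, hfk, hf⟩ := hmem
  obtain ⟨s, t, hs1, ht1, hs, ht, hst, h⟩ := hbound f (zeroNorm_pos.1 hf0)
  rw [ZMod.card] at hs ht
  refine (pqBound_le_mul hq.out.one_le hqp hs1 ht1 hs ht (hst.trans hfk)).trans ?_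
  rw [← hsub hs, ← hsub ht]
  exact_mod_cast h.trans (hf.le.trans hle)

/-! ### Comparison with the general bound -/

theorem mul_sub_lt_of_le {p q K : ℝ} (hq : 2 ≤ q) (hqp : q + 1 ≤ p) (hK : q ≤ K) :
    p * q * (p + q - K) < (p ^ 2 - K / q + 1) * (q ^ 2 - q + 1) := by
  obtain ⟨x, rfl⟩ : ∃ x, K = q * x := ⟨K / q, by field_simp⟩
  have hx : 1 ≤ x := by nlinarith
  rw [mul_div_cancel_left₀ _ (by positivity)]
  -- The difference is affine in `x`: `h1` is its value at `x = 1`, and `h2` is the slope times `x -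
  -- 1`.
  have h1 : 0 < p ^ 2 * (q - 1) ^ 2 :=
    mul_pos (pow_pos (by linarith) 2) (pow_pos (by linarith) 2)
  have h2 : 0 ≤ (x - 1) * ((p - 1) * q ^ 2 + (q - 1)) :=
    mul_nonneg (by linarith) (add_nonneg (mul_nonneg (by linarith) (by positivity)) (by linarith))
  linarith

/-- At `K = p` the left side agrees with that of `mul_sub_lt_of_le`; beyond it the difference grows
with slope `(q - 1) / q`. -/
theorem mul_add_mul_sub_lt_of_le {p q K : ℝ} (hq : 2 ≤ q) (hqp : q + 1 ≤ p) (hK : p ≤ K) :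
    q * (p + p * q - K) < (p ^ 2 - K / q + 1) * (q ^ 2 - q + 1) := by
  have h1 := mul_sub_lt_of_le hq hqp (K := p) (by linarith)
  have h2 : 0 ≤ (K / q - p / q) * (q - 1) :=
    mul_nonneg (sub_nonneg.2 (by gcongr)) (by linarith)
  have h3 : K = q * (K / q) := by field_simp
  have h4 : p = q * (p / q) := by field_simp
  have h5 : q * (p + p * q - K) = p * q * q - q ^ 2 * (K / q) + q ^ 2 * (p / q) := by
    have h6 : q ^ 2 * (K / q) = q * K := by rw [sq, mul_assoc, ← h3]
    have h7 : q ^ 2 * (p / q) = q * p := by rw [sq, mul_assoc, ← h4]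
    rw [h6, h7]
    ring
  rw [h5]
  linarith

/-- The general bound interpolates linearly between consecutive divisors, so at a divisor the
formula of an adjacent interval can be used. Below `q` the difference is `p² (k - 1)(q - 1)`, which
vanishes only at `k = 1`. -/
theorem generalBound_le_pqBound {p q k d₁ d₂ : ℕ} (hp : p.Prime) (hq : q.Prime) (hqp : q < p)
    (hk1 : 1 ≤ k) (hk2 : k ≤ p * q)
    (hd₁ : IsGreatest {d : ℕ | d ∣ p * q ∧ d ≤ k} d₁)
    (hd₂ : IsLeast {d : ℕ | d ∣ p * q ∧ k ≤ d} d₂) :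
    k = 1 ∧ ((p * q : ℕ) : ℝ) ^ 2 / (d₁ * d₂) * (d₁ + d₂ - k) = pqBound p q k ∨
      ((p * q : ℕ) : ℝ) ^ 2 / (d₁ * d₂) * (d₁ + d₂ - k) < pqBound p q k := by
  have hq2 := hq.two_le
  have hpN : p < p * q := by nlinarith
  have hq' : (2 : ℝ) ≤ q := by exact_mod_cast hq2
  have hqp' : (q : ℝ) + 1 ≤ p := by exact_mod_cast hqp
  have hq0 : (q : ℝ) ≠ 0 := by positivity
  have hp0 : (p : ℝ) ≠ 0 := by linarith
  have hdiv : ∀ d, d ∣ p * q → d = 1 ∨ d = q ∨ d = p ∨ d = p * q := by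
    intro d hd
    obtain ⟨x, y, hx, hy, rfl⟩ := (Nat.dvd_mul).1 hd
    rcases (Nat.dvd_prime hp).1 hx with rfl | rfl <;>
      rcases (Nat.dvd_prime hq).1 hy with rfl | rfl <;> simp
  obtain ⟨⟨hd₁N, hd₁k⟩, hmax⟩ := hd₁
  obtain ⟨⟨hd₂N, hd₂k⟩, hmin⟩ := hd₂
  have hmaxq : q ≤ k → q ≤ d₁ := fun h => hmax ⟨dvd_mul_left q p, h⟩
  have hmaxp : p ≤ k → p ≤ d₁ := fun h => hmax ⟨dvd_mul_right p q, h⟩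
  have hmaxN : p * q ≤ k → p * q ≤ d₁ := fun h => hmax ⟨dvd_rfl, h⟩
  have hmin1 : k ≤ 1 → d₂ ≤ 1 := fun h => hmin ⟨one_dvd _, h⟩
  have hminq : k ≤ q → d₂ ≤ q := fun h => hmin ⟨dvd_mul_left q p, h⟩
  have hminp : k ≤ p → d₂ ≤ p := fun h => hmin ⟨dvd_mul_right p q, h⟩
  have large : q ≤ k → pqBound p q k =
      ((p : ℝ) ^ 2 - (k : ℝ) / q + 1) * ((q : ℝ) ^ 2 - q + 1) := fun h => if_neg (not_lt.2 h)
  have mid : q ≤ k → (p : ℝ) * q * (p + q - k) < pqBound p q k := fun h => by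
    rw [large h]
    exact mul_sub_lt_of_le hq' hqp' (by exact_mod_cast h)
  have high : p ≤ k → (q : ℝ) * (p + p * q - k) < pqBound p q k := fun h => by
    rw [large (hqp.le.trans h)]
    exact mul_add_mul_sub_lt_of_le hq' hqp' (by exact_mod_cast h)
  have hcases : (d₁ = 1 ∧ d₂ = 1 ∧ k = 1) ∨ (d₁ = 1 ∧ d₂ = q ∧ 1 < k ∧ k < q) ∨
      (d₁ = q ∧ d₂ = q ∧ k = q) ∨ (d₁ = q ∧ d₂ = p ∧ q ≤ k) ∨ (d₁ = p ∧ d₂ = p ∧ k = p) ∨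
      (d₁ = p ∧ d₂ = p * q ∧ p ≤ k) ∨ (d₁ = p * q ∧ d₂ = p * q ∧ k = p * q) := by
    have h1 := hdiv d₁ hd₁N
    have h2 := hdiv d₂ hd₂N
    generalize p * q = N at *
    rcases h1 with h1 | h1 | h1 | h1 <;> rcases h2 with h2 | h2 | h2 | h2 <;> first
      | (exfalso; omega)
      | exact Or.inl ⟨h1, h2, by omega⟩
      | exact Or.inr (Or.inl ⟨h1, h2, by omega, by omega⟩)
      | exact Or.inr (Or.inr (Or.inl ⟨h1, h2, by omega⟩))
      | exact Or.inr (Or.inr (Or.inr (Or.inl ⟨h1, h2, by omega⟩)))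
      | exact Or.inr (Or.inr (Or.inr (Or.inr (Or.inl ⟨h1, h2, by omega⟩))))
      | exact Or.inr (Or.inr (Or.inr (Or.inr (Or.inr (Or.inl ⟨h1, h2, by omega⟩)))))
      | exact Or.inr (Or.inr (Or.inr (Or.inr (Or.inr (Or.inr ⟨h1, h2, by omega⟩)))))
  push_cast
  rcases hcases with ⟨rfl, rfl, rfl⟩ | ⟨rfl, rfl, h1, h2⟩ | ⟨rfl, rfl, rfl⟩ | ⟨rfl, rfl, h⟩ |
    ⟨rfl, rfl, rfl⟩ | ⟨rfl, rfl, h⟩ | ⟨rfl, rfl, rfl⟩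
  · refine Or.inl ⟨rfl, ?_⟩
    rw [pqBound, if_pos (by omega)]
    push_cast
    ring
  · refine Or.inr ?_
    have h1' : (1 : ℝ) < k := by exact_mod_cast h1
    rw [pqBound, if_pos h2]
    have h3 : 0 < (p : ℝ) ^ 2 * ((k - 1) * (d₂ - 1)) :=
      mul_pos (by positivity) (mul_pos (by linarith) (by linarith))
    have h4 : ((p : ℝ) * d₂) ^ 2 / ((1 : ℕ) * d₂) * ((1 : ℕ) + d₂ - k) =
        p ^ 2 * d₂ * (1 + d₂ - k) := by
      push_cast
      field_simp
    rw [h4]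
    linarith
  · refine Or.inr (lt_of_eq_of_lt ?_ (mid le_rfl))
    field_simp
    ring
  · refine Or.inr (lt_of_eq_of_lt ?_ (mid h))
    field_simp
    ring
  · refine Or.inr (lt_of_eq_of_lt ?_ (mid hqp.le))
    field_simp
    ring
  · refine Or.inr (lt_of_eq_of_lt ?_ (high h))
    push_cast
    field_simp
  · refine Or.inr (lt_of_eq_of_lt ?_ (high hpN.le))
    push_cast
    field_simp
    ring

theorem mainTheorem9 (p q : ℕ) [Fact p.Prime] [Fact q.Prime] (hqp : q < p)
    (k : ℕ) (hk1 : 1 ≤ k) (hk2 : k ≤ p * q) :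
    pqBound p q k ≤ (stftPhi (ZMod (p * q)) k : ℝ) ∧
    ∀ d₁ d₂ : ℕ,
      IsGreatest {d : ℕ | d ∣ p * q ∧ d ≤ k} d₁ →
      IsLeast {d : ℕ | d ∣ p * q ∧ k ≤ d} d₂ →
      ((p * q : ℕ) : ℝ) ^ 2 / (d₁ * d₂) * (d₁ + d₂ - k) ≤ pqBound p q k ∧
      (2 ≤ k →
        ((p * q : ℕ) : ℝ) ^ 2 / (d₁ * d₂) * (d₁ + d₂ - k) < pqBound p q k) := by
  refine ⟨pqBound_le_stftPhi p q hqp k hk1, fun d₁ d₂ hd₁ hd₂ => ?_⟩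
  rcases generalBound_le_pqBound Fact.out Fact.out hqp hk1 hk2 hd₁ hd₂ with ⟨rfl, h⟩ | h
  · exact ⟨h.le, fun h2 => absurd h2 (by norm_num)⟩
  · exact ⟨h.le, fun _ => h⟩
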